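/- Let $(X,m)$ be a probability space and let $(T_t)_{t\in\mathbb R}$ be a measurable flow on $X$ that preserves $m$: $T_0=\mathrm{id}$, $T_{s+t}=T_sT_t$, each $T_t$ is a measure-preserving map, and $(t,x)\mapsto T_tx$ is measurable with respect to the completion of the product of Lebesgue measure and $m$. Assume that the flow is ergodic (every measurable set $B$ with $m(T_t^{-1}B\,\Delta\,B)=0$ for all $t$ has measure $0$ or $1$) and aperiodic (there is no $p>0$ such that $m(T_p^{-1}B\,\Delta\,B)=0$ for every measurable set $B$). Write $T_tf=f\circ T_t$ for $f\in L_1(X,m)$. Let $\nu_n$ $(n\in\mathbb N)$ be Borel probability measures on $\mathbb R$, and let $P_n=\int_{\mathbb R}T_t\,d\nu_n(t)$ be the operator on $L_1(X,m)$ given by $P_nf=\int_{\mathbb R}T_tf\,d\nu_n(t)$ (Bochner integral in $L_1(X,m)$). Then for every real sequence $a_n\to 0^+$, every measurable set $A'\subset X$ with $m(A')>0$ and every $\varepsilon>0$ there exists a measurable set $A\subset X$ with $m(A'\Delta A)<\varepsilon$ such that $$\big\|P_n\mathbf 1_A-m(A)\big\|_{L_1(X,m)}>a_n\quad\text{for infinitely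 many } n .$$ -/

import Mathlib

open MeasureTheory Filter Set Topology
open scoped symmDiff

namespace MeasurableFlow

/-- The Koopman operator `T_t f = f ∘ T_t` on `L¹(X, m)` of the time-`t` map `T_t x = t +ᵥ x` of a
measure-preserving flow, i.e. of a measure-preserving action of the additive group `ℝ`. -/
noncomputable def koopman {X : Type*} [MeasurableSpace X] (m : Measure X)
    [AddAction ℝ X] [MeasurableConstVAdd ℝ X] [VAddInvariantMeasure ℝ X m] (t : ℝ) :
    Lp ℝ 1 m →ₗᵢ[ℝ] Lp ℝ 1 m :=
  Lp.compMeasurePreservingₗᵢ ℝ (fun x : X => t +ᵥ x) (measurePreserving_vadd t m)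

/-- The flow is a *measurable* flow: the map `(t, x) ↦ T_t x` is measurable on `ℝ × X`, where
`ℝ × X` carries the completion of the product of Lebesgue measure and `m`. -/
def IsMeasurableFlow {X : Type*} [MeasurableSpace X] (m : Measure X) [AddAction ℝ X] : Prop :=
  NullMeasurable (fun q : ℝ × X => q.1 +ᵥ q.2) ((volume : Measure ℝ).prod m)

/-- The flow is *aperiodic*: no `T_p` with `p > 0` is trivial modulo null sets, that is, fixes
every measurable set up to a set of measure zero. -/
def IsAperiodicFlow {X : Type*} [MeasurableSpace X] (m : Measure X) [AddAction ℝ X] : Prop :=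
  ∀ p : ℝ, 0 < p → ∃ B : Set X, MeasurableSet B ∧ m (((fun x : X => p +ᵥ x) ⁻¹' B) ∆ B) ≠ 0

section Group

variable {X : Type*} [MeasurableSpace X] {m : Measure X} [AddAction ℝ X]
  [MeasurableConstVAdd ℝ X] [VAddInvariantMeasure ℝ X m]

theorem koopman_add (s t : ℝ) (f : Lp ℝ 1 m) :
    koopman m (s + t) f = koopman m s (koopman m t f) := by
  have h := Lp.compMeasurePreserving_comp_apply f (measurePreserving_vadd t m)
    (measurePreserving_vadd s m)
  refine Eq.trans ?_ h
  have hfun : (fun x : X => (s + t) +ᵥ x) = (fun x => t +ᵥ x) ∘ fun x => s +ᵥ x := by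
    funext x; simp [add_comm s t, add_vadd]
  change Lp.compMeasurePreserving (fun x : X => (s + t) +ᵥ x) _ f = _
  congr! 2

theorem koopman_zero (f : Lp ℝ 1 m) : koopman m 0 f = f :=
  (koopman m 0).injective (by rw [← koopman_add, add_zero])

end Group

section Continuity

variable {X : Type*} [MeasurableSpace X] {m : Measure X} [IsProbabilityMeasure m]

theorem stronglyMeasurable_section {S : Set (ℝ × X)} (hS : MeasurableSet S) (c : ℝ) :
    StronglyMeasurable (fun t : ℝ =>
      indicatorConstLp (μ := m) 1 (measurable_prodMk_left (x := t) hS) (measure_ne_top m _)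
        c) := by
  induction S, hS using MeasurableSpace.induction_on_inter generateFrom_prod.symm isPiSystem_prod with
  | empty =>
    convert stronglyMeasurable_const (α := ℝ) (b := (0 : Lp ℝ 1 m)) using 2
    exact indicatorConstLp_empty
  | basic S hS =>
    obtain ⟨A, hA, B, hB, rfl⟩ := hS
    have hA : MeasurableSet A := hA
    have hB : MeasurableSet B := hB
    convert (stronglyMeasurable_const (α := ℝ)
      (b := indicatorConstLp (μ := m) 1 hB (measure_ne_top m _) c)).indicator hA using 1
    funext t
    by_cases ht : t ∈ A
    · rw [Set.indicator_of_mem ht]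
      congr 1
      ext x; simp [ht]
    · rw [Set.indicator_of_notMem ht, ← indicatorConstLp_empty (μ := m) (p := 1) (c := c)]
      congr 1
      ext x; simp [ht]
  | compl S hS ih =>
    convert (stronglyMeasurable_const (α := ℝ)
      (b := indicatorConstLp (μ := m) 1 MeasurableSet.univ (measure_ne_top m _) c)).sub ih
      using 1
    funext t
    rw [Pi.sub_apply, eq_sub_iff_add_eq, ← indicatorConstLp_disjoint_union]
    · congr 1
      ext x; simp
    · rw [Set.disjoint_left]; intro x hx hx'; exact hx hx'
  | iUnion f hd hf ih =>
    have hU : ∀ n, MeasurableSet (⋃ i < n, f i) := fun n =>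
      MeasurableSet.iUnion fun i => MeasurableSet.iUnion fun _ => hf i
    have h1 : ∀ n, StronglyMeasurable (fun t : ℝ =>
        indicatorConstLp (μ := m) 1 (measurable_prodMk_left (x := t) (hU n)) (measure_ne_top m _)
        c) := by
      intro n
      induction n with
      | zero =>
        convert stronglyMeasurable_const (α := ℝ) (b := (0 : Lp ℝ 1 m)) using 2
        rw [← indicatorConstLp_empty (μ := m) (p := 1) (c := c)]
        congr 1
        simp
      | succ n ihn =>
        convert ihn.add (ih n) using 1
        funext t
        rw [Pi.add_apply, ← indicatorConstLp_disjoint_union]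
        · congr 1
          rw [Set.biUnion_lt_succ]
          rfl
        · refine Disjoint.preimage _ ?_
          simp only [Set.disjoint_iUnion_left]
          intro i hi
          exact hd hi.ne
    refine stronglyMeasurable_of_tendsto atTop h1 ?_
    rw [tendsto_pi_nhds]
    intro t
    refine tendsto_indicatorConstLp_set ENNReal.one_ne_top ?_
    have hanti : Antitone fun n => (Prod.mk t ⁻¹' (⋃ i < n, f i)) ∆ (Prod.mk t ⁻¹' (⋃ i, f i)) := by
      intro a b hab x
      simp only [Set.mem_symmDiff, Set.mem_preimage, Set.mem_iUnion]
      rintro (⟨⟨i, hi, h⟩, h'⟩ | ⟨h, h'⟩)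
      · exact absurd ⟨i, h⟩ h'
      · exact Or.inr ⟨h, fun ⟨i, hi, hx⟩ => h' ⟨i, hi.trans_le hab, hx⟩⟩
    have := tendsto_measure_iInter_atTop (μ := m) (fun n =>
      ((measurable_prodMk_left (x := t) (hU n)).symmDiff
        (measurable_prodMk_left (x := t) (MeasurableSet.iUnion hf))).nullMeasurableSet) hanti
      ⟨0, measure_ne_top m _⟩
    have hempty : ⋂ n, (Prod.mk t ⁻¹' (⋃ i < n, f i)) ∆ (Prod.mk t ⁻¹' (⋃ i, f i)) = ∅ := ?_
    · rwa [hempty, measure_empty] at this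
    rw [Set.eq_empty_iff_forall_notMem]
    intro x hx
    simp only [Set.mem_iInter, Set.mem_symmDiff, Set.mem_preimage, Set.mem_iUnion] at hx
    rcases hx 0 with ⟨⟨i, hi, h⟩, h'⟩ | ⟨⟨i, h⟩, h'⟩
    · exact absurd ⟨i, h⟩ h'
    · rcases hx (i + 1) with ⟨_, h''⟩ | ⟨_, h''⟩
      · exact h'' ⟨i, h⟩
      · exact h'' ⟨i, Nat.lt_succ_self i, h⟩

variable [AddAction ℝ X] [MeasurableConstVAdd ℝ X] [VAddInvariantMeasure ℝ X m]

theorem aestronglyMeasurable_koopman_indicator (hT : IsMeasurableFlow (X := X) m) {B : Set X}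
    (hB : MeasurableSet B) (c : ℝ) :
    AEStronglyMeasurable
      (fun t : ℝ => koopman m t (indicatorConstLp 1 hB (measure_ne_top m B) c)) volume := by
  obtain ⟨S, hS, hSeq⟩ := hT hB
  refine ⟨fun t => indicatorConstLp (μ := m) 1 (measurable_prodMk_left (x := t) hS)
    (measure_ne_top m _) c, stronglyMeasurable_section hS c, ?_⟩
  filter_upwards [Measure.ae_ae_of_ae_prod hSeq] with t ht
  change Lp.compMeasurePreserving (fun x : X => t +ᵥ x) (measurePreserving_vadd t m)
    (indicatorConstLp 1 hB (measure_ne_top m B) c) = _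
  rw [Lp.indicatorConstLp_compMeasurePreserving]
  refine MemLp.toLp_congr _ _ (indicator_ae_eq_of_ae_eq_set ?_)
  filter_upwards [ht] with x hx
  exact hx

/-- A measurable flow acts on `L¹` strongly continuously. -/
theorem continuous_koopman (hT : IsMeasurableFlow (X := X) m) (f : Lp ℝ 1 m) :
    Continuous fun t : ℝ => koopman m t f := by
  induction f using Lp.induction ENNReal.one_ne_top with
  | indicatorConst c hB hμ =>
    rw [Lp.simpleFunc.coe_indicatorConst]
    have hae := aestronglyMeasurable_koopman_indicator hT hB c
    set f := indicatorConstLp 1 hB (measure_ne_top m _) c with hf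
    have hnorm : ∀ s t : ℝ, dist (koopman m s f) (koopman m t f) =
        dist (koopman m (s - t) f) f := by
      intro s t
      rw [← (koopman m t).isometry.dist_eq (koopman m (s - t) f), ← koopman_add]
      congr 3; ring
    have hzero : Tendsto (fun h : ℝ => dist (koopman m h f) f) (𝓝 0) (𝓝 0) := by
      rw [Metric.tendsto_nhds]
      intro ε hε
      obtain ⟨Y, hYsep, hY⟩ := hae.isSeparable_ae_range
      obtain ⟨D, hD, hYD⟩ := hYsep
      have : ∃ y ∈ D, volume ((fun t : ℝ => koopman m t f) ⁻¹' Metric.ball y (ε / 2)) ≠ 0 := by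
        by_contra! hcon
        have h0 : volume (⋃ y ∈ D,
            (fun t : ℝ => koopman m t f) ⁻¹' Metric.ball y (ε / 2)) = 0 :=
          (measure_biUnion_null_iff hD).2 hcon
        have h1 : ∀ᵐ t : ℝ, False := by
          filter_upwards [hY, measure_eq_zero_iff_ae_notMem.1 h0] with t ht ht'
          obtain ⟨y, hy, hdist⟩ := Metric.mem_closure_iff.1 (hYD ht) (ε / 2) (by positivity)
          exact ht' (Set.mem_biUnion hy hdist)
        exact NeZero.ne (volume : Measure ℝ) (by simpa using h1)
      obtain ⟨y, -, hy⟩ := this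
      have hnull : NullMeasurableSet ((fun t : ℝ => koopman m t f) ⁻¹' Metric.ball y (ε / 2))
          volume := by
        borelize ↥(Lp ℝ 1 m)
        exact hae.aemeasurable.nullMeasurable Metric.isOpen_ball.measurableSet
      obtain ⟨E, hEsub, hE, hEeq⟩ := hnull.exists_measurable_subset_ae_eq
      have hpos : 0 < volume E := by
        rw [measure_congr hEeq]; exact pos_iff_ne_zero.2 hy
      filter_upwards [Measure.sub_mem_nhds_zero_of_addHaar_pos volume E hE hpos] with h hh
      obtain ⟨s, hs, t, ht, rfl⟩ := hh
      rw [Real.dist_0_eq_abs, abs_of_nonneg dist_nonneg, ← hnorm]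
      have h1 : dist (koopman m s f) y < ε / 2 := hEsub hs
      have h2 : dist (koopman m t f) y < ε / 2 := hEsub ht
      linarith [dist_triangle_right (koopman m s f) (koopman m t f) y]
    rw [continuous_iff_continuousAt]
    intro t
    rw [ContinuousAt, tendsto_iff_dist_tendsto_zero]
    simp_rw [hnorm _ t]
    refine hzero.comp ?_
    have : Tendsto (fun s : ℝ => s - t) (𝓝 t) (𝓝 (t - t)) := (continuous_sub_right t).tendsto t
    simpa using this
  | add hf hg _ ihf ihg =>
    simp_rw [map_add]
    exact ihf.add ihg
  | isClosed =>
    rw [← isSeqClosed_iff_isClosed]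
    intro u f hu huf
    refine TendstoUniformly.continuous (F := fun n t => koopman m t (u n)) (p := atTop) ?_
      (Eventually.of_forall hu).frequently
    rw [Metric.tendstoUniformly_iff]
    intro ε hε
    filter_upwards [Metric.tendsto_nhds.1 huf ε hε] with n hn t
    rwa [(koopman m t).isometry.dist_eq, dist_comm]

theorem integrable_koopman (hT : IsMeasurableFlow (X := X) m) (ν : Measure ℝ) [IsFiniteMeasure ν]
    (f : Lp ℝ 1 m) : Integrable (fun t : ℝ => koopman m t f) ν :=
  Integrable.of_bound (continuous_koopman hT f).aestronglyMeasurable ‖f‖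
    (Eventually.of_forall fun t => ((koopman m t).norm_map f).le)

end Continuity

/-- The weighted average `P = ∫ T_t dν(t)` of a measurable flow, as a bounded operator on
`L¹(X, m)`: `P f` is the Bochner integral in `L¹(X, m)` of `t ↦ T_t f` against `ν`. -/
noncomputable def weightedAverage {X : Type*} [MeasurableSpace X] {m : Measure X}
    [IsProbabilityMeasure m] [AddAction ℝ X] [MeasurableConstVAdd ℝ X]
    [VAddInvariantMeasure ℝ X m] (hT : IsMeasurableFlow (X := X) m)
    (ν : Measure ℝ) [IsProbabilityMeasure ν] : Lp ℝ 1 m →L[ℝ] Lp ℝ 1 m :=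
  LinearMap.mkContinuous
    { toFun := fun f => ∫ t, koopman m t f ∂ν
      map_add' := fun f g => by
        simp_rw [map_add]
        exact integral_add (integrable_koopman hT ν f) (integrable_koopman hT ν g)
      map_smul' := fun c f => by
        simp_rw [map_smul]
        exact integral_smul c _ }
    1 (fun f => by
      refine (norm_integral_le_of_norm_le_const
        (Eventually.of_forall fun t => ((koopman m t).norm_map f).le)).trans ?_
      simp)

end MeasurableFlow

/-! The proof is a Baire category argument. Indicators form a closed, hence complete, subset of
`L¹`. With `D_n f = P_n f - ∫ f`, the indicators having `‖D_n 1_A‖ > a_n` for some `n ≥ N` form an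
open set. If these sets are dense, their intersection over `N` is dense and meets the `ε`-ball
around `1_{A'}`.

Density needs, for each `n`, small sets `B` on which `‖D_n 1_B‖` is at least a constant multiple of
a bound for `m B`. Since `1_B` is the difference of the indicators of `A' ∪ B` and `A' \ B`, one of
these two perturbations of `A'` then deviates by at least half as much, while `a_n` tends to 0.

Such a `B` exists if `B` hardly moves under `T_t` for `|t| < L`, where `ν_n` has little mass outside
`(-L, L)`: then `P_n 1_B` is close to `1_B`, which is far from its mean (`exists_meanDeviation_ge`).

Almost invariant sets of prescribed measure (`exists_almost_invariant`) arise by sweeping a set `E`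
along the flow. If `E` does not return for a long time, sweeping for a long but shorter time covers
little, so the measure passes the prescribed level late, when growth per time `L` is already slow.

Such an `E` (`exists_return_free`) comes from aperiodicity. Occupation times are Lipschitz along
orbits and detect each nontrivial `T_p`. Compactness and the zero-one law give finitely many of them
that exclude approximate returns on a set of positive measure; a piece of that set where they are
nearly constant serves as `E`.

Sweeps and returns use rational times only, so all unions are countable; continuity in the measure
algebra recovers real times. -/

namespace MeasurableFlow

/-! ### Continuity in the measure algebra and the zero-one law -/

section SetContinuity

variable {X : Type*} [MeasurableSpace X] {m : Measure X} [IsProbabilityMeasure m]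

theorem dist_indicatorConstLp_one {B C : Set X} (hB : MeasurableSet B) (hC : MeasurableSet C) :
    dist (indicatorConstLp 1 hB (measure_ne_top m B) (1 : ℝ))
      (indicatorConstLp 1 hC (measure_ne_top m C) (1 : ℝ)) = m.real (B ∆ C) := by
  rw [dist_indicatorConstLp_eq_norm, norm_indicatorConstLp one_ne_zero ENNReal.one_ne_top]
  simp

variable [AddAction ℝ X] [MeasurableConstVAdd ℝ X] [VAddInvariantMeasure ℝ X m]

theorem koopman_indicatorConstLp {B : Set X} (hB : MeasurableSet B) (c t : ℝ) :
    koopman m t (indicatorConstLp 1 hB (measure_ne_top m B) c) =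
      indicatorConstLp 1 (hB.preimage (measurable_const_vadd t)) (measure_ne_top m _) c :=
  Lp.indicatorConstLp_compMeasurePreserving _ _ _ (measurePreserving_vadd t m)

theorem norm_koopman_indicator_sub {B : Set X} (hB : MeasurableSet B) (t : ℝ) :
    ‖koopman m t (indicatorConstLp 1 hB (measure_ne_top m B) (1 : ℝ)) -
      indicatorConstLp 1 hB (measure_ne_top m B) (1 : ℝ)‖ =
      m.real (((fun x : X => t +ᵥ x) ⁻¹' B) ∆ B) := by
  rw [koopman_indicatorConstLp, ← dist_eq_norm, dist_indicatorConstLp_one]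

/-- A measurable flow moves every measurable set continuously in the measure algebra. -/
theorem continuous_measureReal_preimage_symmDiff (hT : IsMeasurableFlow (X := X) m) {B : Set X}
    (hB : MeasurableSet B) :
    Continuous fun t : ℝ => m.real (((fun x : X => t +ᵥ x) ⁻¹' B) ∆ B) := by
  simp_rw [← norm_koopman_indicator_sub hB]
  exact ((continuous_koopman hT _).sub continuous_const).norm

end SetContinuity

section RationalTimes

variable {X : Type*} [MeasurableSpace X] {m : Measure X} [IsProbabilityMeasure m]
  [AddAction ℝ X] [MeasurableConstVAdd ℝ X]

/-- For an ergodic measurable flow, invariance under rational times suffices for the zero-one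
law. -/
theorem null_or_conull_of_rat_invariant [ErgodicVAdd ℝ X m]
    (hT : IsMeasurableFlow (X := X) m) {S : Set X} (hS : NullMeasurableSet S m)
    (hinv : ∀ q : ℚ, (fun x : X => (q : ℝ) +ᵥ x) ⁻¹' S =ᵐ[m] S) : m S = 0 ∨ m Sᶜ = 0 := by
  obtain ⟨B, hB, hSB⟩ := hS
  -- Displacement is continuous in time, so its zero set is closed and contains the rationals.
  have hinvB : ∀ t : ℝ, m.real (((fun x : X => t +ᵥ x) ⁻¹' B) ∆ B) = 0 := by
    refine fun t => Rat.isDenseEmbedding_coe_real.dense.induction_on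
      (p := fun t : ℝ => m.real (((fun x : X => t +ᵥ x) ⁻¹' B) ∆ B) = 0) t
      (isClosed_eq (continuous_measureReal_preimage_symmDiff hT hB) continuous_const) ?_
    rintro q
    rw [measureReal_eq_zero_iff, measure_symmDiff_eq_zero_iff]
    exact (((measurePreserving_vadd (q : ℝ) m).quasiMeasurePreserving.preimage_ae_eq
      hSB).symm.trans (hinv q)).trans hSB
  have hconst := ErgodicVAdd.aeconst_of_forall_preimage_vadd_ae_eq (G := ℝ) (μ := m) hB
    fun t => by
      rw [← measure_symmDiff_eq_zero_iff, ← measureReal_eq_zero_iff]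
      exact hinvB t
  rcases eventuallyConst_set'.1 hconst with h | h
  · left
    exact measure_eq_zero_iff_ae_notMem.2 ((hSB.trans h).mem_iff.mono fun x hx => by simpa using hx)
  · right
    exact measure_eq_zero_iff_ae_notMem.2 ((hSB.trans h).mem_iff.mono fun x hx => by simpa using hx)

end RationalTimes

/-! ### Occupation times as observables -/

section Sections

variable {X : Type*} [MeasurableSpace X] {m : Measure X} [IsProbabilityMeasure m]

theorem ae_section_ae_eq {S S' : Set (ℝ × X)} (h : S =ᵐ[(volume : Measure ℝ).prod m] S') :
    ∀ᵐ x ∂m, volume ((fun t : ℝ => (t, x)) ⁻¹' S) = volume ((fun t : ℝ => (t, x)) ⁻¹' S') := by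
  have h2 : ∀ᵐ z ∂(m.prod (volume : Measure ℝ)), (z.swap ∈ S ↔ z.swap ∈ S') := by
    have := h.mem_iff
    rw [← Measure.prod_swap] at this
    exact ae_of_ae_map measurable_swap.aemeasurable this
  filter_upwards [Measure.ae_ae_of_ae_prod h2] with x hx
  exact measure_congr (Filter.eventuallyEq_set.2 hx)

theorem aemeasurable_volume_section {S : Set (ℝ × X)}
    (hS : NullMeasurableSet S ((volume : Measure ℝ).prod m)) :
    AEMeasurable (fun x => volume ((fun t : ℝ => (t, x)) ⁻¹' S)) m := by
  obtain ⟨S', hS', h⟩ := hS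
  exact ⟨_, measurable_measure_prodMk_right hS', ae_section_ae_eq h⟩

theorem lintegral_volume_section {S : Set (ℝ × X)}
    (hS : NullMeasurableSet S ((volume : Measure ℝ).prod m)) :
    ∫⁻ x, volume ((fun t : ℝ => (t, x)) ⁻¹' S) ∂m =
      ∫⁻ t, m ((fun x : X => (t, x)) ⁻¹' S) ∂volume := by
  obtain ⟨S', hS', h⟩ := hS
  have h1 : ∀ᵐ t ∂(volume : Measure ℝ),
      m ((fun x : X => (t, x)) ⁻¹' S) = m ((fun x : X => (t, x)) ⁻¹' S') := by
    filter_upwards [Measure.ae_ae_of_ae_prod h.mem_iff] with t ht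
    exact measure_congr (Filter.eventuallyEq_set.2 ht)
  rw [lintegral_congr_ae (ae_section_ae_eq h), lintegral_congr_ae h1,
    ← Measure.prod_apply_symm hS', ← Measure.prod_apply hS']

end Sections

section Occupation

variable {X : Type*} [AddAction ℝ X]

/-- The time that the orbit of `x` spends in `B` during `[0, θ]`. -/
noncomputable def occupation (B : Set X) (θ : ℝ) (x : X) : ℝ :=
  volume.real {t : ℝ | t ∈ Icc 0 θ ∧ t +ᵥ x ∈ B}

theorem volume_ne_top_of_subset_Icc {θ : ℝ} {s : Set ℝ} (hs : s ⊆ Icc 0 θ) : volume s ≠ ⊤ :=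
  ((measure_mono hs).trans_lt (by simp)).ne

/-- Moving the point by `s` shifts the time window by `s`, which adds at most length `|s|`. Only
outer measure properties of `volume` are used, so the bound holds at every point, even where the set
of times is not measurable. -/
theorem occupation_vadd_le (B : Set X) (θ s : ℝ) (x : X) :
    occupation B θ (s +ᵥ x) ≤ occupation B θ x + |s| := by
  have hshift : volume.real {t : ℝ | t ∈ Icc 0 θ ∧ t +ᵥ (s +ᵥ x) ∈ B} =
      volume.real {t : ℝ | t ∈ Icc s (s + θ) ∧ t +ᵥ x ∈ B} := by
    rw [measureReal_def, measureReal_def,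
      ← measure_preimage_add_right volume s {t : ℝ | t ∈ Icc s (s + θ) ∧ t +ᵥ x ∈ B}]
    congr 2
    ext t
    simp only [mem_ofPred_eq, mem_preimage, mem_Icc, vadd_vadd]
    refine and_congr_left fun _ => ⟨fun h => ⟨?_, ?_⟩, fun h => ⟨?_, ?_⟩⟩ <;> linarith [h.1, h.2]
  have hsub : {t : ℝ | t ∈ Icc s (s + θ) ∧ t +ᵥ x ∈ B} ⊆
      {t : ℝ | t ∈ Icc 0 θ ∧ t +ᵥ x ∈ B} ∪ (Icc (min s 0) 0 ∪ Icc θ (max (s + θ) θ)) := by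
    rintro t ⟨⟨h1, h2⟩, hB⟩
    simp only [mem_union, mem_ofPred_eq, mem_Icc]
    by_cases h0 : 0 ≤ t
    · by_cases hθ : t ≤ θ
      · exact Or.inl ⟨⟨h0, hθ⟩, hB⟩
      · exact Or.inr (Or.inr ⟨by linarith, le_max_of_le_left h2⟩)
    · exact Or.inr (Or.inl ⟨min_le_of_left_le h1, by linarith⟩)
  have hfin : volume {t : ℝ | t ∈ Icc 0 θ ∧ t +ᵥ x ∈ B} ≠ ⊤ :=
    volume_ne_top_of_subset_Icc fun t ht => ht.1
  have hlen : volume.real (Icc (min s 0) 0) + volume.real (Icc θ (max (s + θ) θ)) = |s| := by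
    rw [Real.volume_real_Icc_of_le (min_le_right _ _),
      Real.volume_real_Icc_of_le (le_max_right _ _)]
    rcases le_total 0 s with h | h
    · rw [min_eq_right h, max_eq_left (by linarith), abs_of_nonneg h]; ring
    · rw [min_eq_left h, max_eq_right (by linarith), abs_of_nonpos h]; ring
  calc occupation B θ (s +ᵥ x) = volume.real {t : ℝ | t ∈ Icc s (s + θ) ∧ t +ᵥ x ∈ B} := hshift
    _ ≤ volume.real ({t : ℝ | t ∈ Icc 0 θ ∧ t +ᵥ x ∈ B} ∪
          (Icc (min s 0) 0 ∪ Icc θ (max (s + θ) θ))) := by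
        refine measureReal_mono hsub ?_
        refine (measure_union_lt_top hfin.lt_top (measure_union_lt_top ?_ ?_)).ne <;> simp
    _ ≤ occupation B θ x + (volume.real (Icc (min s 0) 0) +
          volume.real (Icc θ (max (s + θ) θ))) := by
        refine (measureReal_union_le _ _).trans ?_
        exact add_le_add le_rfl (measureReal_union_le _ _)
    _ = _ := by rw [hlen]

theorem abs_occupation_vadd_sub_le (B : Set X) (θ s : ℝ) (x : X) :
    |occupation B θ (s +ᵥ x) - occupation B θ x| ≤ |s| := by
  rw [abs_sub_le_iff]
  constructor
  · linarith [occupation_vadd_le B θ s x]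
  · have := occupation_vadd_le B θ (-s) (s +ᵥ x)
    rw [neg_vadd_vadd, abs_neg] at this
    linarith

/-- The window splits into times when `x` is outside `B`, all mismatches for `x`, and times when `x`
is inside. The latter have the same measure as the times when `y` is inside, all mismatches for `y`.
-/
theorem ofReal_le_volume_mismatch_add {B : Set X} {θ : ℝ} {x y : X} (hx : x ∈ B)
    (hy : y ∉ B) (hxy : occupation B θ x = occupation B θ y) :
    ENNReal.ofReal θ ≤ volume {t : ℝ | t ∈ Icc 0 θ ∧ ¬(t +ᵥ x ∈ B ↔ x ∈ B)} +
      volume {t : ℝ | t ∈ Icc 0 θ ∧ ¬(t +ᵥ y ∈ B ↔ y ∈ B)} := by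
  have hxy' : volume {t : ℝ | t ∈ Icc 0 θ ∧ t +ᵥ x ∈ B} =
      volume {t : ℝ | t ∈ Icc 0 θ ∧ t +ᵥ y ∈ B} :=
    (ENNReal.toReal_eq_toReal_iff' (volume_ne_top_of_subset_Icc fun t ht => ht.1)
      (volume_ne_top_of_subset_Icc fun t ht => ht.1)).1 hxy
  calc ENNReal.ofReal θ = volume (Icc 0 θ) := by simp
    _ ≤ volume ({t : ℝ | t ∈ Icc 0 θ ∧ ¬(t +ᵥ x ∈ B ↔ x ∈ B)} ∪
          {t : ℝ | t ∈ Icc 0 θ ∧ t +ᵥ x ∈ B}) := by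
        refine measure_mono fun t ht => ?_
        by_cases h : t +ᵥ x ∈ B
        · exact Or.inr ⟨ht, h⟩
        · exact Or.inl ⟨ht, by simp [h, hx]⟩
    _ ≤ _ := by
        refine (measure_union_le _ _).trans ?_
        rw [hxy']
        gcongr
        rintro hB
        simp [hB, hy]

variable [MeasurableSpace X] {m : Measure X}

theorem nullMeasurableSet_flow_preimage (hT : IsMeasurableFlow (X := X) m) {B : Set X}
    (hB : MeasurableSet B) (θ : ℝ) :
    NullMeasurableSet {q : ℝ × X | q.1 ∈ Icc 0 θ ∧ q.1 +ᵥ q.2 ∈ B}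
      ((volume : Measure ℝ).prod m) :=
  ((measurableSet_Icc (a := (0 : ℝ)) (b := θ)).preimage measurable_fst).nullMeasurableSet.inter
    (hT hB)

variable [IsProbabilityMeasure m]

theorem aemeasurable_occupation (hT : IsMeasurableFlow (X := X) m) {B : Set X}
    (hB : MeasurableSet B) (θ : ℝ) : AEMeasurable (occupation B θ) m :=
  (aemeasurable_volume_section (nullMeasurableSet_flow_preimage hT hB θ)).ennreal_toReal

variable [MeasurableConstVAdd ℝ X] [VAddInvariantMeasure ℝ X m]

/-- The occupation times of a set that the time-`p` map moves are not all invariant under that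
map. -/
theorem exists_occupation_not_ae_eq (hT : IsMeasurableFlow (X := X) m) {B : Set X}
    (hB : MeasurableSet B) {p : ℝ} (hp : m (((fun x : X => p +ᵥ x) ⁻¹' B) ∆ B) ≠ 0) :
    ∃ θ : ℝ, ¬ ∀ᵐ x ∂m, occupation B θ (p +ᵥ x) = occupation B θ x := by
  set D := ((fun x : X => p +ᵥ x) ⁻¹' B) ∆ B with hD
  have hDm : MeasurableSet D := (hB.preimage (measurable_const_vadd p)).symmDiff hB
  have hd : 0 < m.real D := ENNReal.toReal_pos hp (measure_ne_top m _)
  have hev : ∀ᶠ t in 𝓝 (0 : ℝ), m.real (((fun x : X => t +ᵥ x) ⁻¹' B) ∆ B) < m.real D / 4 := by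
    refine (continuous_measureReal_preimage_symmDiff hT hB).continuousAt.eventually_lt
      continuousAt_const ?_
    simpa using hd
  obtain ⟨δ, hδ, hball⟩ := Metric.eventually_nhds_iff.1 hev
  -- On this window `B` moves by less than a quarter of `m D`, so the mean mismatch time is at most
  -- `θ * m D / 4`. If occupation were `p`-invariant, each point of `D` and its image would share
  -- mismatch at least `θ`, giving `θ * m D ≤ θ * m D / 2`.
  refine ⟨δ / 2, fun hocc => ?_⟩
  set θ := δ / 2 with hθ
  have hθ0 : 0 < θ := by positivity
  set S : Set (ℝ × X) := {q | q.1 ∈ Icc 0 θ ∧ ¬(q.1 +ᵥ q.2 ∈ B ↔ q.2 ∈ B)} with hS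
  have hSm : NullMeasurableSet S ((volume : Measure ℝ).prod m) := by
    have h1 : NullMeasurableSet (((fun q : ℝ × X => q.1 +ᵥ q.2) ⁻¹' B) ∆ (Prod.snd ⁻¹' B))
        ((volume : Measure ℝ).prod m) :=
      NullMeasurableSet.symmDiff (hT hB) (hB.preimage measurable_snd).nullMeasurableSet
    convert ((measurableSet_Icc (a := (0 : ℝ)) (b := θ)).preimage
      measurable_fst).nullMeasurableSet.inter h1 using 1
    ext q
    simp only [hS, mem_ofPred_eq, mem_inter_iff, mem_preimage, mem_symmDiff]
    tauto
  set g : X → ENNReal := fun x => volume ((fun t : ℝ => (t, x)) ⁻¹' S) with hg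
  have hgm : AEMeasurable g m := aemeasurable_volume_section hSm
  have hmp := measurePreserving_vadd p m
  have hgint : ∫⁻ x, g x ∂m ≤ ENNReal.ofReal (m.real D / 4) * ENNReal.ofReal θ := by
    rw [hg, lintegral_volume_section hSm]
    calc ∫⁻ t, m ((fun x : X => (t, x)) ⁻¹' S) ∂volume
        ≤ ∫⁻ t, (Icc 0 θ).indicator (fun _ => ENNReal.ofReal (m.real D / 4)) t ∂volume := by
          refine lintegral_mono fun t => ?_
          by_cases ht : t ∈ Icc 0 θ
          · rw [indicator_of_mem ht]
            have : (fun x : X => (t, x)) ⁻¹' S = ((fun x : X => t +ᵥ x) ⁻¹' B) ∆ B := by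
              ext x
              simp only [hS, mem_ofPred_eq, mem_preimage, mem_symmDiff, ht, true_and]
              tauto
            rw [this, ← ofReal_measureReal]
            refine ENNReal.ofReal_le_ofReal (hball ?_).le
            rw [Real.dist_0_eq_abs, abs_of_nonneg ht.1]
            linarith [ht.2]
          · have : (fun x : X => (t, x)) ⁻¹' S = ∅ := by
              ext x
              simp only [hS, mem_ofPred_eq, mem_preimage, ht, false_and, mem_empty_iff_false]
            simp [this]
      _ = _ := by
          rw [lintegral_indicator_const measurableSet_Icc]
          simp
  have hgp : ∫⁻ x, g (p +ᵥ x) ∂m = ∫⁻ x, g x ∂m := by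
    have h := lintegral_map' (f := g) (g := fun x : X => p +ᵥ x) (μ := m)
      (by rw [hmp.map_eq]; exact hgm) hmp.aemeasurable
    rw [hmp.map_eq] at h
    exact h.symm
  have hlow : ENNReal.ofReal θ * m D ≤ ∫⁻ x, g x + g (p +ᵥ x) ∂m := by
    rw [← lintegral_indicator_const hDm]
    refine lintegral_mono_ae ?_
    filter_upwards [hocc] with x hx
    by_cases hxD : x ∈ D
    · rw [indicator_of_mem hxD]
      rcases hxD with ⟨h1, h2⟩ | ⟨h1, h2⟩
      · rw [add_comm]
        exact ofReal_le_volume_mismatch_add h1 h2 hx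
      · exact ofReal_le_volume_mismatch_add h1 h2 hx.symm
    · simp [hxD]
  rw [lintegral_add_left' hgm, hgp] at hlow
  have hfin := hlow.trans (add_le_add hgint hgint)
  rw [← ofReal_measureReal, ← ENNReal.ofReal_mul hθ0.le, ← ENNReal.ofReal_mul (by positivity),
    ← ENNReal.ofReal_add (by positivity) (by positivity),
    ENNReal.ofReal_le_ofReal_iff (by positivity)] at hfin
  nlinarith [mul_pos hd hθ0]

end Occupation

/-! ### Approximate returns and return-free sets -/

section Recurrence

variable {X : Type*} [AddAction ℝ X] {ι : Type*}

/-- The points at which, for every finite part of the family `F` and every precision, some rational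
time in `I` is an approximate return time. -/
def almostReturning (F : ι → X → ℝ) (I : Set ℝ) : Set X :=
  {x | ∀ (J : Finset ι) (n : ℕ), ∃ q : ℚ, (q : ℝ) ∈ I ∧
    ∀ j ∈ J, |F j ((q : ℝ) +ᵥ x) - F j x| ≤ 1 / ((n : ℝ) + 1)}

theorem almostReturning_mono (F : ι → X → ℝ) {I I' : Set ℝ} (h : I ⊆ I') :
    almostReturning F I ⊆ almostReturning F I' := by
  intro x hx J n
  obtain ⟨q, hq, hj⟩ := hx J n
  exact ⟨q, h hq, hj⟩

theorem almostReturning_union_subset (F : ι → X → ℝ) (I I' : Set ℝ) :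
    almostReturning F (I ∪ I') ⊆ almostReturning F I ∪ almostReturning F I' := by
  classical
  intro x hx
  by_contra hcon
  simp only [mem_union, not_or, almostReturning, mem_ofPred_eq, not_forall] at hcon
  obtain ⟨⟨J, n, h⟩, J', n', h'⟩ := hcon
  obtain ⟨q, hq, hj⟩ := hx (J ∪ J') (max n n')
  have hle : ∀ k : ℕ, k ≤ max n n' → 1 / (((max n n' : ℕ) : ℝ) + 1) ≤ 1 / ((k : ℝ) + 1) :=
    fun k hk => Nat.one_div_le_one_div hk
  rcases hq with hq | hq
  · exact h ⟨q, hq, fun j hjJ => (hj j (Finset.mem_union_left _ hjJ)).trans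
      (hle n (le_max_left _ _))⟩
  · exact h' ⟨q, hq, fun j hjJ => (hj j (Finset.mem_union_right _ hjJ)).trans
      (hle n' (le_max_right _ _))⟩

/-- Times commute, so testing returns of the translated point against `F i` is testing returns of
`x` against a translate of `F i`, again in the family. -/
theorem almostReturning_vadd {F : ι → X → ℝ}
    (hF : ∀ (i : ι) (q : ℚ), ∃ j, ∀ x, F j x = F i ((q : ℝ) +ᵥ x)) {I : Set ℝ} {x : X}
    (hx : x ∈ almostReturning F I) (s : ℚ) : (s : ℝ) +ᵥ x ∈ almostReturning F I := by
  classical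
  intro J n
  choose τ hτ using fun i => hF i s
  obtain ⟨q, hq, hj⟩ := hx (J.image τ) n
  refine ⟨q, hq, fun j hjJ => ?_⟩
  have := hj (τ j) (Finset.mem_image_of_mem τ hjJ)
  rwa [hτ, hτ, vadd_vadd, add_comm, ← vadd_vadd] at this

/-- A point almost returning at times arbitrarily close to `p` returns at time `p`, as far as
observables that are Lipschitz along orbits can tell. -/
theorem eq_of_almostReturning_ball {F : ι → X → ℝ}
    (hLip : ∀ i (s : ℝ) (x : X), |F i (s +ᵥ x) - F i x| ≤ |s|) {p : ℝ} {x : X}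
    (hx : ∀ n : ℕ, x ∈ almostReturning F (Metric.ball p (1 / ((n : ℝ) + 1)))) (i : ι) :
    F i (p +ᵥ x) = F i x := by
  have hbound : ∀ n : ℕ, |F i (p +ᵥ x) - F i x| ≤ 2 * (1 / ((n : ℝ) + 1)) := by
    intro n
    obtain ⟨q, hq, hj⟩ := hx n {i} n
    have h1 := hj i (Finset.mem_singleton_self i)
    have h2 := hLip i (p - q) ((q : ℝ) +ᵥ x)
    rw [vadd_vadd, sub_add_cancel] at h2
    rw [Metric.mem_ball, dist_comm, Real.dist_eq] at hq
    have h3 := abs_sub_le (F i (p +ᵥ x)) (F i ((q : ℝ) +ᵥ x)) (F i x)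
    linarith
  have hlim : Tendsto (fun n : ℕ => 2 * (1 / ((n : ℝ) + 1))) atTop (𝓝 0) := by
    simpa using (tendsto_one_div_add_atTop_nhds_zero_nat (𝕜 := ℝ)).const_mul 2
  have := ge_of_tendsto' hlim hbound
  exact sub_eq_zero.1 (abs_eq_zero.1 (le_antisymm this (abs_nonneg _)))

variable [MeasurableSpace X] {m : Measure X} [MeasurableConstVAdd ℝ X] [VAddInvariantMeasure ℝ X m]

theorem aemeasurable_comp_vadd {f : X → ℝ} (hf : AEMeasurable f m) (t : ℝ) :
    AEMeasurable (fun x => f (t +ᵥ x)) m :=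
  hf.comp_quasiMeasurePreserving (measurePreserving_vadd t m).quasiMeasurePreserving

theorem nullMeasurableSet_displacement_le {f : X → ℝ} (hf : AEMeasurable f m) (t c : ℝ) :
    NullMeasurableSet {x | |f (t +ᵥ x) - f x| ≤ c} m :=
  nullMeasurableSet_le ((aemeasurable_comp_vadd hf t).sub hf).abs aemeasurable_const

theorem nullMeasurableSet_almostReturning [Countable ι] {F : ι → X → ℝ}
    (hF : ∀ i, AEMeasurable (F i) m) (I : Set ℝ) :
    NullMeasurableSet (almostReturning F I) m := by
  have : almostReturning F I = ⋂ (J : Finset ι) (n : ℕ), ⋃ (q : ℚ) (_ : (q : ℝ) ∈ I),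
      ⋂ j ∈ J, {x | |F j ((q : ℝ) +ᵥ x) - F j x| ≤ 1 / ((n : ℝ) + 1)} := by
    ext x
    simp [almostReturning]
  rw [this]
  exact .iInter fun J => .iInter fun n => .iUnion fun q => .iUnion fun _ =>
    .biInter J.countable_toSet fun j _ => nullMeasurableSet_displacement_le (hF j) _ _

end Recurrence

section ReturnFree

variable {X : Type*} [MeasurableSpace X] {m : Measure X} [IsProbabilityMeasure m]
  [AddAction ℝ X] [MeasurableConstVAdd ℝ X]

/-- By compactness it is enough to find a null neighbourhood of each `p`. Otherwise the zero-one law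
makes almost every point return at times arbitrarily close to `p`; the Lipschitz bound turns this
into invariance of every observable under time `p`, against `hmove`. -/
theorem measure_almostReturning_eq_zero [ErgodicVAdd ℝ X m] {ι : Type*} [Countable ι]
    (hT : IsMeasurableFlow (X := X) m) {F : ι → X → ℝ} (hFm : ∀ i, AEMeasurable (F i) m)
    (hLip : ∀ i (s : ℝ) (x : X), |F i (s +ᵥ x) - F i x| ≤ |s|)
    (hF : ∀ (i : ι) (q : ℚ), ∃ j, ∀ x, F j x = F i ((q : ℝ) +ᵥ x)) {K : Set ℝ} (hK : IsCompact K)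
    (hmove : ∀ p ∈ K, ∃ i, ¬ ∀ᵐ x ∂m, F i (p +ᵥ x) = F i x) :
    m (almostReturning F K) = 0 := by
  have h01 : ∀ I : Set ℝ, m (almostReturning F I) = 0 ∨ m (almostReturning F I)ᶜ = 0 := by
    intro I
    refine null_or_conull_of_rat_invariant hT (nullMeasurableSet_almostReturning hFm I) fun q => ?_
    refine Filter.EventuallyEq.of_eq (Set.ext fun x => ⟨fun h => ?_, fun h => ?_⟩)
    · have := almostReturning_vadd hF h (-q)
      rwa [Rat.cast_neg, neg_vadd_vadd] at this
    · exact almostReturning_vadd hF h q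
  refine hK.induction_on (p := fun I => m (almostReturning F I) = 0) ?_ ?_ ?_ ?_
  · refine measure_mono_null (t := ∅) ?_ measure_empty
    intro x hx
    obtain ⟨q, hq, -⟩ := hx ∅ 0
    exact hq.elim
  · exact fun I I' h h0 => measure_mono_null (almostReturning_mono F h) h0
  · exact fun I I' h h' =>
      measure_mono_null (almostReturning_union_subset F I I') (measure_union_null h h')
  · intro p hp
    by_contra hcon
    obtain ⟨i, hi⟩ := hmove p hp
    have hfull : ∀ n : ℕ, m (almostReturning F (Metric.ball p (1 / ((n : ℝ) + 1))))ᶜ = 0 := by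
      intro n
      refine (h01 _).resolve_left fun h => hcon ⟨_, ?_, h⟩
      exact mem_nhdsWithin_of_mem_nhds (Metric.ball_mem_nhds p Nat.one_div_pos_of_nat)
    refine hi ?_
    filter_upwards [ae_all_iff.2 fun n => mem_ae_iff.2 (hfull n)] with x hx
    exact eq_of_almostReturning_ball hLip hx i

/-- An ergodic aperiodic flow admits sets of positive measure that avoid themselves during an
arbitrarily long time. -/
theorem exists_return_free [ErgodicVAdd ℝ X m] (hT : IsMeasurableFlow (X := X) m)
    (hap : IsAperiodicFlow (X := X) m) {r Q : ℝ} (hr : 0 < r) :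
    ∃ E : Set X, MeasurableSet E ∧ m E ≠ 0 ∧
      ∀ q : ℚ, (q : ℝ) ∈ Icc r Q → ∀ x ∈ E, (q : ℝ) +ᵥ x ∉ E := by
  have hobs : ∀ p ∈ Icc r Q, ∃ f : X → ℝ, AEMeasurable f m ∧
      (∀ (s : ℝ) (x : X), |f (s +ᵥ x) - f x| ≤ |s|) ∧ ¬ ∀ᵐ x ∂m, f (p +ᵥ x) = f x := by
    intro p hp
    obtain ⟨B, hB, hBp⟩ := hap p (hr.trans_le hp.1)
    obtain ⟨θ, hθ⟩ := exists_occupation_not_ae_eq hT hB hBp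
    exact ⟨occupation B θ, aemeasurable_occupation hT hB θ, abs_occupation_vadd_sub_le B θ, hθ⟩
  choose! f hfm hfLip hfmove using hobs
  -- Closedness lets the observable chosen for `p` also detect all times near `p`, so finitely many
  -- observables serve the whole interval.
  have hclosed : ∀ p ∈ Icc r Q, IsClosed {t : ℝ | ∀ᵐ x ∂m, f p (t +ᵥ x) = f p x} := by
    intro p hp
    refine IsSeqClosed.isClosed fun u t hu hut => ?_
    filter_upwards [ae_all_iff.2 hu] with x hx
    have hlim : Tendsto (fun n => |t - u n|) atTop (𝓝 0) := by
      simpa using ((tendsto_const_nhds (x := t)).sub hut).abs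
    have h0 : |f p (t +ᵥ x) - f p x| ≤ 0 := by
      refine ge_of_tendsto' hlim fun n => ?_
      have := hfLip p hp (t - u n) (u n +ᵥ x)
      rwa [vadd_vadd, sub_add_cancel, hx n] at this
    exact sub_eq_zero.1 (abs_eq_zero.1 (le_antisymm h0 (abs_nonneg _)))
  obtain ⟨P, hP, hcover⟩ := isCompact_Icc.elim_nhds_subcover
    (fun p => {t : ℝ | ∀ᵐ x ∂m, f p (t +ᵥ x) = f p x}ᶜ)
    (fun p hp => (hclosed p hp).isOpen_compl.mem_nhds (hfmove p hp))
  -- Adding rational translates keeps the family countable and makes the almost returning sets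
  -- invariant under rational times.
  let F : P × ℚ → X → ℝ := fun i x => f i.1 ((i.2 : ℝ) +ᵥ x)
  have hFm : ∀ i, AEMeasurable (F i) m := fun i =>
    aemeasurable_comp_vadd (hfm i.1 (hP i.1 i.1.2)) _
  have hFLip : ∀ i (s : ℝ) (x : X), |F i (s +ᵥ x) - F i x| ≤ |s| := by
    intro i s x
    have := hfLip i.1 (hP i.1 i.1.2) s ((i.2 : ℝ) +ᵥ x)
    rwa [vadd_vadd, add_comm, ← vadd_vadd] at this
  have hFtrans : ∀ (i : P × ℚ) (q : ℚ), ∃ j, ∀ x, F j x = F i ((q : ℝ) +ᵥ x) := by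
    intro i q
    refine ⟨(i.1, i.2 + q), fun x => ?_⟩
    simp only [F, vadd_vadd, Rat.cast_add]
  have hzero : m (almostReturning F (Icc r Q)) = 0 := by
    refine measure_almostReturning_eq_zero hT hFm hFLip hFtrans isCompact_Icc fun p hp => ?_
    obtain ⟨p', hp', hmem⟩ := mem_iUnion₂.1 (hcover hp)
    refine ⟨(⟨p', hp'⟩, 0), fun h => hmem ?_⟩
    simpa [F] using h
  have hgood : ∃ (J : Finset (P × ℚ)) (n : ℕ),
      m {x | ∃ q : ℚ, (q : ℝ) ∈ Icc r Q ∧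
        ∀ j ∈ J, |F j ((q : ℝ) +ᵥ x) - F j x| ≤ 1 / ((n : ℝ) + 1)}ᶜ ≠ 0 := by
    by_contra! hcon
    have : m (almostReturning F (Icc r Q))ᶜ = 0 := by
      refine measure_mono_null ?_ (measure_iUnion_null fun J => measure_iUnion_null fun n =>
        hcon J n)
      intro x hx
      simpa [almostReturning] using hx
    have h1 := measure_union_null hzero this
    rw [union_compl_self, measure_univ] at h1
    exact one_ne_zero h1
  obtain ⟨J, n, hG⟩ := hgood
  set G := {x | ∃ q : ℚ, (q : ℝ) ∈ Icc r Q ∧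
        ∀ j ∈ J, |F j ((q : ℝ) +ᵥ x) - F j x| ≤ 1 / ((n : ℝ) + 1)}ᶜ with hGdef
  have hGm : NullMeasurableSet G m := by
    have : G = (⋃ (q : ℚ) (_ : (q : ℝ) ∈ Icc r Q),
        ⋂ j ∈ J, {x | |F j ((q : ℝ) +ᵥ x) - F j x| ≤ 1 / ((n : ℝ) + 1)})ᶜ := by
      rw [hGdef]
      congr 1
      ext x
      simp
    rw [this]
    exact (NullMeasurableSet.iUnion fun q => .iUnion fun _ =>
      .biInter J.countable_toSet fun j _ => nullMeasurableSet_displacement_le (hFm j) _ _).compl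
  -- Two points of one cell differ by less than `1 / (n + 1)` in every observable of `J`, so a
  -- return to the cell would be an approximate return, which `G` forbids.
  let cell : (J → ℤ) → Set X := fun v => ⋂ j : J, {x | ⌊((n : ℝ) + 1) * F j x⌋ = v j}
  have hcell : ∀ v, NullMeasurableSet (cell v) m := fun v => .iInter fun j =>
    (Int.measurable_floor.comp_aemeasurable ((hFm j).const_mul ((n : ℝ) + 1))).nullMeasurable
      (measurableSet_singleton (v j))
  have hpos : ∃ v, m (G ∩ cell v) ≠ 0 := by
    by_contra! hcon
    refine hG (measure_mono_null ?_ (measure_iUnion_null hcon))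
    intro x hx
    exact mem_iUnion.2 ⟨fun j => ⌊((n : ℝ) + 1) * F j x⌋, hx, mem_iInter.2 fun j => rfl⟩
  obtain ⟨v, hv⟩ := hpos
  obtain ⟨E, hEsub, hE, hEeq⟩ := (hGm.inter (hcell v)).exists_measurable_subset_ae_eq
  refine ⟨E, hE, by rwa [measure_congr hEeq], fun q hq x hx hqx => (hEsub hx).1 ⟨q, hq, ?_⟩⟩
  intro j hj
  have h1 : ⌊((n : ℝ) + 1) * F j x⌋ = v ⟨j, hj⟩ := mem_iInter.1 (hEsub hx).2 ⟨j, hj⟩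
  have h2 : ⌊((n : ℝ) + 1) * F j ((q : ℝ) +ᵥ x)⌋ = v ⟨j, hj⟩ :=
    mem_iInter.1 (hEsub hqx).2 ⟨j, hj⟩
  have h3 := Int.abs_sub_lt_one_of_floor_eq_floor (h2.trans h1.symm)
  have hn : (0 : ℝ) < (n : ℝ) + 1 := by positivity
  rw [← mul_sub, abs_mul, abs_of_pos hn] at h3
  rw [le_div_iff₀ hn]
  linarith

end ReturnFree

/-! ### Almost invariant sets by sweeping -/

section Sweep

variable {X : Type*} [AddAction ℝ X]

/-- The points whose orbit meets `E` at a rational time of absolute value at most `u`. -/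
def sweep (E : Set X) (u : ℚ) : Set X := {x | ∃ q : ℚ, |q| ≤ u ∧ (q : ℝ) +ᵥ x ∈ E}

theorem sweep_mono (E : Set X) {u v : ℚ} (h : u ≤ v) : sweep E u ⊆ sweep E v :=
  fun _ ⟨q, hq, hx⟩ => ⟨q, hq.trans h, hx⟩

theorem vadd_mem_sweep {E : Set X} {u v q : ℚ} {x : X} (hx : x ∈ sweep E u) (h : u + |q| ≤ v) :
    (q : ℝ) +ᵥ x ∈ sweep E v := by
  obtain ⟨p, hp, hpx⟩ := hx
  refine ⟨p - q, (abs_sub p q).trans (by linarith), ?_⟩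
  rwa [vadd_vadd, Rat.cast_sub, sub_add_cancel]

theorem mem_sweep_of_vadd_mem {E : Set X} {u v q : ℚ} {x : X} (hx : (q : ℝ) +ᵥ x ∈ sweep E u)
    (h : u + |q| ≤ v) : x ∈ sweep E v := by
  have := vadd_mem_sweep (q := -q) (v := v) hx (by rwa [abs_neg])
  rwa [Rat.cast_neg, neg_vadd_vadd] at this

/-- The points that reach `E` within time `(k + 1) * L` but not within time `k * L`. -/
def shell (E : Set X) (L : ℚ) (k : ℕ) : Set X := sweep E ((k + 1) * L) \ sweep E (k * L)

/-- Moving time `i * L` towards the hit of `E` shortens the waiting time by exactly that amount. It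
cannot land in the sweep of radius `j * L`, since then `x` would lie in the sweep of radius `(j + i)
* L`. -/
theorem shell_subset {E : Set X} {L : ℚ} (hL : 0 < L) (i j : ℕ) :
    shell E L (j + i) ⊆ (fun x : X => ((i * L : ℚ) : ℝ) +ᵥ x) ⁻¹' shell E L j ∪
      (fun x : X => ((-(i * L) : ℚ) : ℝ) +ᵥ x) ⁻¹' shell E L j := by
  rintro x ⟨⟨q, hq, hqx⟩, hx⟩
  have hi : (0 : ℚ) ≤ i * L := by positivity
  have hj : (0 : ℚ) ≤ j * L := by positivity
  have hfar : ∀ p : ℚ, |p| = i * L → (p : ℝ) +ᵥ x ∉ sweep E (j * L) := by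
    intro p hp h
    refine hx (mem_sweep_of_vadd_mem h ?_)
    rw [hp]
    push_cast
    linarith
  have hq' : (j + i : ℚ) * L < |q| := by
    by_contra! h
    exact hx ⟨q, by push_cast; exact h, hqx⟩
  push_cast at hq
  rcases le_total 0 q with h0 | h0
  · left
    rw [abs_of_nonneg h0] at hq hq'
    refine ⟨⟨q - i * L, ?_, ?_⟩, hfar _ (abs_of_nonneg hi)⟩
    · rw [abs_of_nonneg] <;> linarith
    · rwa [vadd_vadd, Rat.cast_sub, sub_add_cancel]
  · right
    rw [abs_of_nonpos h0] at hq hq'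
    refine ⟨⟨q - -(i * L), ?_, ?_⟩, hfar _ (by rw [abs_neg, abs_of_nonneg hi])⟩
    · rw [abs_of_nonpos] <;> linarith
    · rwa [vadd_vadd, Rat.cast_sub, sub_add_cancel]

variable [MeasurableSpace X] [MeasurableConstVAdd ℝ X]

theorem measurableSet_sweep {E : Set X} (hE : MeasurableSet E) (u : ℚ) :
    MeasurableSet (sweep E u) := by
  have : sweep E u = ⋃ (q : ℚ) (_ : |q| ≤ u), (fun x : X => (q : ℝ) +ᵥ x) ⁻¹' E := by
    ext x
    simp [sweep]
  rw [this]
  exact .iUnion fun q => .iUnion fun _ => hE.preimage (measurable_const_vadd _)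

variable {m : Measure X}

theorem measureReal_preimage_vadd [VAddInvariantMeasure ℝ X m] {B : Set X} (hB : MeasurableSet B)
    (t : ℝ) : m.real ((fun x : X => t +ᵥ x) ⁻¹' B) = m.real B :=
  (measurePreserving_vadd t m).measureReal_preimage hB.nullMeasurableSet

variable [IsProbabilityMeasure m]

/-- A set that does not return during a long time sweeps out little during a short time. -/
theorem mul_measureReal_sweep_le_one [VAddInvariantMeasure ℝ X m] {E : Set X}
    (hE : MeasurableSet E) {s : ℚ} (hs : 0 ≤ s) (N : ℕ)
    (hfree : ∀ q : ℚ, (q : ℝ) ∈ Icc 1 ((N : ℝ) * (2 * s + 1) + 2 * s) → ∀ x ∈ E,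
      (q : ℝ) +ᵥ x ∉ E) :
    (N : ℝ) * m.real (sweep E s) ≤ 1 := by
  let A : ℕ → Set X := fun i => (fun x : X => (((i : ℚ) * (2 * s + 1) : ℚ) : ℝ) +ᵥ x) ⁻¹' sweep E s
  have hA : ∀ i, MeasurableSet (A i) := fun i =>
    (measurableSet_sweep hE s).preimage (measurable_const_vadd _)
  have hlt : ∀ i j : ℕ, i < j → j < N → Disjoint (A i) (A j) := by
    intro i j hij hj
    rw [Set.disjoint_left]
    rintro x ⟨q, hq, hqx⟩ ⟨p, hp, hpx⟩
    have h1 : (i : ℚ) + 1 ≤ j := by exact_mod_cast hij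
    have h2 : (j : ℚ) ≤ N := by exact_mod_cast hj.le
    have h3 : (0 : ℚ) ≤ i := by positivity
    rw [abs_le] at hq hp
    -- Consecutive translates are `2 * s + 1` apart and each hit is off by at most `s`, so a common
    -- point yields a return time of at least 1.
    refine hfree ((p + j * (2 * s + 1)) - (q + i * (2 * s + 1))) ?_ _ hqx ?_
    · have e1 : (1 : ℚ) ≤ (p + j * (2 * s + 1)) - (q + i * (2 * s + 1)) := by nlinarith
      have e2 : (p + j * (2 * s + 1)) - (q + i * (2 * s + 1)) ≤ N * (2 * s + 1) + 2 * s := by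
        nlinarith
      exact ⟨by exact_mod_cast e1, by exact_mod_cast e2⟩
    · rw [vadd_vadd] at hpx ⊢
      rw [vadd_vadd]
      convert hpx using 2
      push_cast
      ring
  have hdisj : Set.PairwiseDisjoint (Finset.range N : Set ℕ) A := by
    intro i hi j hj hij
    simp only [Finset.coe_range, mem_Iio] at hi hj
    rcases lt_or_gt_of_ne hij with h | h
    · exact hlt i j h hj
    · exact (hlt j i h hi).symm
  calc (N : ℝ) * m.real (sweep E s) = ∑ i ∈ Finset.range N, m.real (A i) := by
        simp [A, measureReal_preimage_vadd (measurableSet_sweep hE s)]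
    _ = m.real (⋃ i ∈ Finset.range N, A i) :=
        (measureReal_biUnion_finset hdisj fun i _ => hA i).symm
    _ ≤ 1 := measureReal_le_one

theorem measurableSet_shell {E : Set X} (hE : MeasurableSet E) (L : ℚ) (k : ℕ) :
    MeasurableSet (shell E L k) :=
  (measurableSet_sweep hE _).diff (measurableSet_sweep hE _)

theorem measureReal_shell {E : Set X} (hE : MeasurableSet E) {L : ℚ} (hL : 0 ≤ L) (k : ℕ) :
    m.real (shell E L k) =
      m.real (sweep E (((k + 1 : ℕ) : ℚ) * L)) - m.real (sweep E (k * L)) := by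
  rw [shell, measureReal_sdiff (sweep_mono E (by nlinarith)) (measurableSet_sweep hE _)]
  simp

/-- Each of the `k + 1` shells up to index `k` has at least half the measure of shell `k`, by
`shell_subset`, and their measures telescope to at most 1. -/
theorem measureReal_shell_le [VAddInvariantMeasure ℝ X m] {E : Set X} (hE : MeasurableSet E)
    {L : ℚ} (hL : 0 < L) (k : ℕ) : m.real (shell E L k) ≤ 2 / ((k : ℝ) + 1) := by
  have hcmp : ∀ j ∈ Finset.range (k + 1), m.real (shell E L k) ≤ 2 * m.real (shell E L j) := by
    intro j hj
    obtain ⟨i, rfl⟩ := Nat.exists_eq_add_of_le (Nat.lt_succ_iff.1 (Finset.mem_range.1 hj))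
    refine (measureReal_mono (shell_subset hL i j)).trans ((measureReal_union_le _ _).trans ?_)
    rw [measureReal_preimage_vadd (measurableSet_shell hE L j),
      measureReal_preimage_vadd (measurableSet_shell hE L j), two_mul]
  have hsum := Finset.sum_le_sum hcmp
  rw [← Finset.mul_sum] at hsum
  simp_rw [measureReal_shell (m := m) hE hL.le] at hsum
  rw [Finset.sum_range_sub (fun j : ℕ => m.real (sweep E (j * L)))] at hsum
  rw [le_div_iff₀ (by positivity), measureReal_shell hE hL.le]
  simp only [Finset.sum_const, Finset.card_range, nsmul_eq_mul] at hsum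
  have h1 : m.real (sweep E (((k + 1 : ℕ) : ℚ) * L)) ≤ 1 := measureReal_le_one
  have h2 : 0 ≤ m.real (sweep E (((0 : ℕ) : ℚ) * L)) := measureReal_nonneg
  push_cast at hsum h1 h2 ⊢
  linarith

/-- Points entering under a shift by at most `L` lie in shell `k`. Points leaving are, after
translation, points entering under the opposite shift. -/
theorem measureReal_preimage_sweep_symmDiff_le [VAddInvariantMeasure ℝ X m] {E : Set X}
    (hE : MeasurableSet E) {L : ℚ} (hL : 0 < L) (k : ℕ) {s : ℚ} (hs : |s| ≤ L) :
    m.real (((fun x : X => (s : ℝ) +ᵥ x) ⁻¹' sweep E (k * L)) ∆ sweep E (k * L)) ≤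
      4 / ((k : ℝ) + 1) := by
  have hout : ∀ p : ℚ, |p| ≤ L →
      m.real (((fun x : X => (p : ℝ) +ᵥ x) ⁻¹' sweep E (k * L)) \ sweep E (k * L)) ≤
        2 / ((k : ℝ) + 1) := fun p hp =>
    (measureReal_mono (s₂ := shell E L k) fun x hx =>
      ⟨mem_sweep_of_vadd_mem hx.1 (by linarith), hx.2⟩).trans (measureReal_shell_le hE hL k)
  have hm := measurableSet_sweep hE (k * L)
  have hin : m.real (sweep E (k * L) \ ((fun x : X => (s : ℝ) +ᵥ x) ⁻¹' sweep E (k * L))) ≤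
      2 / ((k : ℝ) + 1) := by
    refine le_trans (le_of_eq ?_) (hout (-s) (by rwa [abs_neg]))
    rw [← measureReal_preimage_vadd ((hm.preimage (measurable_const_vadd _)).diff hm) (s : ℝ)]
    congr 1
    ext x
    simp [vadd_vadd]
  refine (measureReal_union_le _ _).trans ?_
  calc _ ≤ 2 / ((k : ℝ) + 1) + 2 / ((k : ℝ) + 1) := add_le_add (hout s hs) hin
    _ = _ := by ring

theorem exists_lt_measureReal_sweep [ErgodicVAdd ℝ X m] (hT : IsMeasurableFlow (X := X) m)
    {E : Set X} (hE : MeasurableSet E) (hE0 : m E ≠ 0) {L : ℚ} (hL : 0 < L) {η : ℝ} (hη : η < 1) :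
    ∃ k : ℕ, η < m.real (sweep E (k * L)) := by
  set U := ⋃ k : ℕ, sweep E (k * L) with hU
  have hUm : MeasurableSet U := .iUnion fun k => measurableSet_sweep hE _
  have hstep : ∀ (q : ℚ) (x : X), x ∈ U → (q : ℝ) +ᵥ x ∈ U := by
    intro q x hx
    obtain ⟨k, hk⟩ := mem_iUnion.1 hx
    obtain ⟨n, hn⟩ := exists_nat_ge (|q| / L)
    rw [div_le_iff₀ hL] at hn
    refine mem_iUnion.2 ⟨k + n, vadd_mem_sweep hk ?_⟩
    push_cast
    linarith
  have hinv : ∀ q : ℚ, (fun x : X => (q : ℝ) +ᵥ x) ⁻¹' U =ᵐ[m] U := by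
    refine fun q => Filter.EventuallyEq.of_eq (Set.ext fun x => ⟨fun h => ?_, hstep q x⟩)
    have := hstep (-q) _ h
    rwa [Rat.cast_neg, neg_vadd_vadd] at this
  have hU1 : m U = 1 := by
    refine (prob_compl_eq_zero_iff hUm).1
      ((null_or_conull_of_rat_invariant hT hUm.nullMeasurableSet hinv).resolve_left fun h => hE0 ?_)
    refine measure_mono_null (fun x hx => ?_) h
    exact mem_iUnion.2 ⟨0, 0, by simp, by simpa using hx⟩
  have hlim : Tendsto (fun k : ℕ => m.real (sweep E (k * L))) atTop (𝓝 1) := by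
    have hmono : Monotone fun k : ℕ => sweep E (k * L) := fun a b hab =>
      sweep_mono E (mul_le_mul_of_nonneg_right (by exact_mod_cast hab) hL.le)
    have := (ENNReal.tendsto_toReal (measure_ne_top m U)).comp
      (tendsto_measure_iUnion_atTop (μ := m) hmono)
    rw [hU1] at this
    exact this
  exact (hlim.eventually (lt_mem_nhds hη)).exists

/-- An ergodic aperiodic flow has almost invariant sets of any prescribed intermediate measure. -/
theorem exists_almost_invariant [ErgodicVAdd ℝ X m] (hT : IsMeasurableFlow (X := X) m)
    (hap : IsAperiodicFlow (X := X) m) {η κ : ℝ} (hη0 : 0 < η) (hη1 : η < 1) (hκ : 0 < κ)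
    {L : ℕ} (hL : 0 < L) :
    ∃ B : Set X, MeasurableSet B ∧ η < m.real B ∧ m.real B ≤ η + κ ∧
      ∀ s : ℝ, |s| < L → m.real (((fun x : X => s +ᵥ x) ⁻¹' B) ∆ B) ≤ κ := by
  have hLQ : (0 : ℚ) < L := by exact_mod_cast hL
  obtain ⟨k₀, hk₀⟩ := exists_nat_ge (4 / κ)
  obtain ⟨N, hN⟩ := exists_nat_ge (1 / η)
  have hsmall : ∀ k : ℕ, k₀ ≤ k → 4 / ((k : ℝ) + 1) ≤ κ := by
    intro k hk
    have : (k₀ : ℝ) ≤ k := by exact_mod_cast hk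
    rw [div_le_iff₀ hκ] at hk₀
    rw [div_le_iff₀ (by positivity)]
    nlinarith
  -- This horizon is what `mul_measureReal_sweep_le_one` requires at radius `k₀ * L`; there the
  -- sweep has measure at most `1 / N ≤ η`.
  obtain ⟨E, hE, hE0, hfree⟩ := exists_return_free hT hap (r := 1)
    (Q := (N : ℝ) * (2 * ((k₀ * L : ℚ) : ℝ) + 1) + 2 * ((k₀ * L : ℚ) : ℝ)) one_pos
  have hstart : m.real (sweep E (k₀ * L)) ≤ η := by
    have h := mul_measureReal_sweep_le_one (m := m) hE (s := k₀ * L) (by positivity) N hfree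
    rw [div_le_iff₀ hη0] at hN
    have h0 : 0 ≤ m.real (sweep E (k₀ * L)) := measureReal_nonneg
    have hNpos : (0 : ℝ) < N := by
      by_contra! hcon
      nlinarith
    nlinarith
  have hex := exists_lt_measureReal_sweep hT hE hE0 hLQ hη1
  classical
  -- The first radius exceeding `η` has index above `k₀`, so the overshoot, being shell `k - 1`, and
  -- the displacement are both at most `κ`.
  set k := Nat.find hex with hk
  have hkη : η < m.real (sweep E (k * (L : ℚ))) := Nat.find_spec hex
  have hk₀k : k₀ < k := by
    by_contra! hcon
    refine absurd hkη (not_lt.2 ((measureReal_mono (sweep_mono E ?_)).trans hstart))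
    exact mul_le_mul_of_nonneg_right (by exact_mod_cast hcon) hLQ.le
  obtain ⟨j, hj⟩ : ∃ j, k = j + 1 := ⟨k - 1, by omega⟩
  have hjη : m.real (sweep E (j * (L : ℚ))) ≤ η := not_lt.1 (Nat.find_min hex (by omega))
  refine ⟨sweep E (k * L), measurableSet_sweep hE _, hkη, ?_, ?_⟩
  · have h1 := measureReal_shell (m := m) hE hLQ.le j
    have h2 := measureReal_shell_le (m := m) hE hLQ j
    have h3 := hsmall j (by omega)
    have h4 : 2 / ((j : ℝ) + 1) ≤ 4 / ((j : ℝ) + 1) := by gcongr; norm_num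
    rw [hj]
    linarith
  · intro s hs
    have hdense := Rat.isDenseEmbedding_coe_real.dense.open_subset_closure_inter
      (isOpen_lt continuous_abs (continuous_const (y := (L : ℝ)))) hs
    have hcl : IsClosed {s : ℝ | m.real (((fun x : X => s +ᵥ x) ⁻¹' sweep E (k * (L : ℚ))) ∆
        sweep E (k * (L : ℚ))) ≤ κ} :=
      isClosed_le (continuous_measureReal_preimage_symmDiff hT (measurableSet_sweep hE _))
        continuous_const
    refine closure_minimal ?_ hcl hdense
    rintro _ ⟨hq, q, rfl⟩
    refine (measureReal_preimage_sweep_symmDiff_le hE hLQ k ?_).trans (hsmall k hk₀k.le)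
    have hq' : |(q : ℝ)| < L := hq
    exact_mod_cast hq'.le

end Sweep

/-! ### Indicators and deviation from the mean -/

section Indicators

variable {X : Type*} [MeasurableSpace X] {m : Measure X} [IsProbabilityMeasure m]

/-- A subsequence converges almost everywhere, so the limit takes only the values 0 and 1. -/
theorem isClosed_setOf_indicatorConstLp :
    IsClosed {f : Lp ℝ 1 m | ∃ (A : Set X) (hA : MeasurableSet A),
      indicatorConstLp 1 hA (measure_ne_top m A) (1 : ℝ) = f} := by
  refine IsSeqClosed.isClosed fun u f hu huf => ?_
  obtain ⟨φ, -, hφ⟩ := (tendstoInMeasure_of_tendsto_Lp huf).exists_seq_tendsto_ae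
  choose A hA hAu using hu
  have hvals : ∀ᵐ x ∂m, f x = 0 ∨ f x = 1 := by
    have hall : ∀ᵐ x ∂m, ∀ n, u n x = (A n).indicator (fun _ => (1 : ℝ)) x := by
      refine ae_all_iff.2 fun n => ?_
      rw [← hAu n]
      exact indicatorConstLp_coeFn
    filter_upwards [hφ, hall] with x hx hx'
    have hmem : ∀ n, u (φ n) x ∈ ({0, 1} : Set ℝ) := by
      intro n
      rw [hx']
      by_cases h : x ∈ A (φ n) <;> simp [h]
    simpa using (Set.toFinite ({0, 1} : Set ℝ)).isClosed.mem_of_tendsto hx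
      (Eventually.of_forall hmem)
  have hB : MeasurableSet {x | f x = 1} :=
    (Lp.stronglyMeasurable f).measurable (measurableSet_singleton (1 : ℝ))
  refine ⟨{x | f x = 1}, hB, Lp.ext ?_⟩
  filter_upwards [hvals, indicatorConstLp_coeFn (p := 1) (μ := m) (hs := hB)
    (hμs := measure_ne_top m _) (c := (1 : ℝ))] with x hx hx'
  rw [hx']
  rcases hx with h | h
  · rw [h, indicator_of_notMem]
    simp [h]
  · rw [h, indicator_of_mem]
    exact h

theorem norm_indicator_sub_const_ge {B : Set X} (hB : MeasurableSet B) :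
    m.real B * (1 - m.real B) ≤
      ‖indicatorConstLp 1 hB (measure_ne_top m B) (1 : ℝ) - Lp.const 1 m (m.real B)‖ := by
  have hae : (fun x => ‖(indicatorConstLp 1 hB (measure_ne_top m B) (1 : ℝ) -
      Lp.const 1 m (m.real B) : Lp ℝ 1 m) x‖) =ᵐ[m]
      fun x => |B.indicator (fun _ => (1 : ℝ)) x - m.real B| := by
    filter_upwards [Lp.coeFn_sub (indicatorConstLp 1 hB (measure_ne_top m B) (1 : ℝ))
      (Lp.const 1 m (m.real B)), indicatorConstLp_coeFn (p := 1) (μ := m) (hs := hB)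
      (hμs := measure_ne_top m _) (c := (1 : ℝ)), Lp.coeFn_const 1 m (m.real B)] with x h1 h2 h3
    rw [h1, Pi.sub_apply, h2, h3, Real.norm_eq_abs]
    rfl
  have hint : Integrable (fun x => |B.indicator (fun _ => (1 : ℝ)) x - m.real B|) m :=
    (((integrable_const (1 : ℝ)).indicator hB).sub (integrable_const _)).abs
  rw [L1.norm_eq_integral_norm, integral_congr_ae hae]
  calc m.real B * (1 - m.real B) = ∫ x, B.indicator (fun _ => 1 - m.real B) x ∂m := by
        rw [integral_indicator_const _ hB, smul_eq_mul]
    _ ≤ _ := by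
        refine integral_mono ((integrable_const _).indicator hB) hint fun x => ?_
        by_cases h : x ∈ B
        · simpa [h] using le_abs_self (1 - m.real B)
        · simp [h]

end Indicators

section WeightedAverage

variable {X : Type*} [MeasurableSpace X] {m : Measure X} [IsProbabilityMeasure m]
  [AddAction ℝ X] [MeasurableConstVAdd ℝ X]

/-- The weighted average of a function minus its mean. -/
noncomputable def meanDeviation [VAddInvariantMeasure ℝ X m] (hT : IsMeasurableFlow (X := X) m)
    (ν : Measure ℝ) [IsProbabilityMeasure ν] : Lp ℝ 1 m →L[ℝ] Lp ℝ 1 m :=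
  weightedAverage hT ν - (Lp.constL 1 m ℝ).comp L1.integralCLM

theorem meanDeviation_indicator [VAddInvariantMeasure ℝ X m] (hT : IsMeasurableFlow (X := X) m)
    (ν : Measure ℝ) [IsProbabilityMeasure ν] {A : Set X} (hA : MeasurableSet A) :
    meanDeviation hT ν (indicatorConstLp 1 hA (measure_ne_top m A) (1 : ℝ)) =
      weightedAverage hT ν (indicatorConstLp 1 hA (measure_ne_top m A) (1 : ℝ)) -
        Lp.const 1 m (m.real A) := by
  have h : L1.integralCLM (indicatorConstLp 1 hA (measure_ne_top m A) (1 : ℝ)) = m.real A := by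
    rw [← L1.integral_eq, L1.integral_eq_integral, integral_indicatorConstLp]
    simp
  simp [meanDeviation, h]

/-- On an almost invariant set of intermediate measure a weighted average is far from the mean. -/
theorem exists_meanDeviation_ge [ErgodicVAdd ℝ X m] (hT : IsMeasurableFlow (X := X) m)
    (hap : IsAperiodicFlow (X := X) m) (ν : Measure ℝ) [IsProbabilityMeasure ν] {η : ℝ}
    (hη0 : 0 < η) (hη1 : η ≤ 1 / 4) :
    ∃ (B : Set X) (hB : MeasurableSet B), m.real B ≤ 2 * η ∧
      η / 4 ≤ ‖meanDeviation hT ν (indicatorConstLp 1 hB (measure_ne_top m B) (1 : ℝ))‖ := by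
  -- Averaging costs `κ` from times below `L` and `κ` from the tail of `ν`, in total `η / 4`; the
  -- distance of the indicator from its mean is at least `η / 2`.
  set κ := η / 8 with hκ
  have hκ0 : 0 < κ := by positivity
  obtain ⟨L, hL0, hL⟩ : ∃ L : ℕ, 0 < L ∧ ν.real {t : ℝ | |t| < L}ᶜ < κ := by
    have hmono : Antitone fun L : ℕ => {t : ℝ | |t| < L}ᶜ := fun a b hab =>
      compl_subset_compl.2 fun t (ht : |t| < a) => ht.trans_le (by exact_mod_cast hab)
    have hmeas : ∀ L : ℕ, MeasurableSet {t : ℝ | |t| < L}ᶜ := fun L =>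
      (isOpen_lt continuous_abs continuous_const).measurableSet.compl
    have hlim := tendsto_measure_iInter_atTop (μ := ν) (fun L => (hmeas L).nullMeasurableSet)
      hmono ⟨0, measure_ne_top ν _⟩
    have hempty : ⋂ L : ℕ, {t : ℝ | |t| < L}ᶜ = ∅ := by
      rw [Set.eq_empty_iff_forall_notMem]
      intro t ht
      obtain ⟨L, hL⟩ := exists_nat_gt |t|
      exact mem_iInter.1 ht L hL
    rw [hempty, measure_empty] at hlim
    have hlim' := (ENNReal.tendsto_toReal ENNReal.zero_ne_top).comp hlim
    obtain ⟨L, h1, h2⟩ := ((hlim'.eventually (gt_mem_nhds (by simpa using hκ0))).and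
      (eventually_gt_atTop 0)).exists
    exact ⟨L, h2, h1⟩
  obtain ⟨B, hB, hBη, hBκ, hinv⟩ :=
    exists_almost_invariant hT hap hη0 (by linarith) hκ0 hL0
  refine ⟨B, hB, by linarith, ?_⟩
  set f := indicatorConstLp 1 hB (measure_ne_top m B) (1 : ℝ) with hf
  have hclose : ‖weightedAverage hT ν f - f‖ ≤ 2 * κ := by
    have hW : weightedAverage hT ν f - f = ∫ t, (koopman m t f - f) ∂ν := by
      rw [integral_sub (integrable_koopman hT ν f) (integrable_const f)]
      simp [weightedAverage]
    have hS : MeasurableSet {t : ℝ | |t| < L}ᶜ :=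
      (isOpen_lt continuous_abs continuous_const).measurableSet.compl
    rw [hW]
    calc ‖∫ t, (koopman m t f - f) ∂ν‖
        ≤ ∫ t, (κ + {t : ℝ | |t| < L}ᶜ.indicator (fun _ => (1 : ℝ)) t) ∂ν := by
          refine norm_integral_le_of_norm_le
            ((integrable_const κ).add ((integrable_const (1 : ℝ)).indicator hS))
            (Eventually.of_forall fun t => ?_)
          rw [norm_koopman_indicator_sub hB]
          by_cases ht : |t| < L
          · simpa [ht] using hinv t ht
          · have : m.real (((fun x : X => t +ᵥ x) ⁻¹' B) ∆ B) ≤ 1 := measureReal_le_one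
            have h1 : {t : ℝ | |t| < L}ᶜ.indicator (fun _ => (1 : ℝ)) t = 1 :=
              indicator_of_mem ht _
            rw [h1]
            linarith
      _ = κ + ν.real {t : ℝ | |t| < L}ᶜ := by
          rw [integral_add (integrable_const κ) ((integrable_const (1 : ℝ)).indicator hS),
            integral_indicator_const _ hS]
          simp
      _ ≤ 2 * κ := by linarith
  have hfar := norm_indicator_sub_const_ge (m := m) hB
  have htri := norm_sub_le_norm_sub_add_norm_sub f (weightedAverage hT ν f)
    (Lp.const 1 m (m.real B))
  rw [norm_sub_rev f (weightedAverage hT ν f)] at htri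
  have hb : η / 2 ≤ m.real B * (1 - m.real B) := by nlinarith
  rw [meanDeviation_indicator]
  linarith

theorem exists_lt_meanDeviation_near [ErgodicVAdd ℝ X m] (hT : IsMeasurableFlow (X := X) m)
    (hap : IsAperiodicFlow (X := X) m) (ν : ℕ → Measure ℝ) [∀ n, IsProbabilityMeasure (ν n)]
    {a : ℕ → ℝ} (ha : Tendsto a atTop (𝓝 0)) {A' : Set X} (hA' : MeasurableSet A') {ε : ℝ}
    (hε : 0 < ε) (N : ℕ) :
    ∃ (A : Set X) (hA : MeasurableSet A), m.real (A' ∆ A) < ε ∧ ∃ n ≥ N,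
      a n < ‖meanDeviation hT (ν n) (indicatorConstLp 1 hA (measure_ne_top m A) (1 : ℝ))‖ := by
  by_contra! hcon
  obtain ⟨η, hη0, hη1, hηε⟩ : ∃ η : ℝ, 0 < η ∧ η ≤ 1 / 4 ∧ 2 * η < ε :=
    ⟨min (1 / 4) (ε / 3), by positivity, min_le_left _ _,
      by linarith [min_le_right (1 / 4) (ε / 3)]⟩
  obtain ⟨n, hna, hnN⟩ := ((ha.eventually (gt_mem_nhds (show (0 : ℝ) < η / 8 by positivity))).and
    (eventually_ge_atTop N)).exists
  obtain ⟨B, hB, hBη, hBdev⟩ := exists_meanDeviation_ge hT hap (ν n) hη0 hη1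
  have hU : m.real (A' ∆ (A' \ B ∪ B)) < ε :=
    (measureReal_mono (s₂ := B) fun x hx => by
      simp only [mem_symmDiff, mem_union, Set.mem_sdiff] at hx; tauto).trans_lt (hBη.trans_lt hηε)
  have hD : m.real (A' ∆ (A' \ B)) < ε :=
    (measureReal_mono (s₂ := B) fun x hx => by
      simp only [mem_symmDiff, Set.mem_sdiff] at hx; tauto).trans_lt (hBη.trans_lt hηε)
  have h1 := hcon _ ((hA'.diff hB).union hB) hU n hnN
  have h2 := hcon _ (hA'.diff hB) hD n hnN
  -- If both perturbations deviated by at most `a n < η / 8`, their difference, the indicator of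
  -- `B`, would deviate by less than `η / 4`.
  rw [indicatorConstLp_disjoint_union (hA'.diff hB) hB (measure_ne_top m _) (measure_ne_top m _)
    disjoint_sdiff_left, map_add] at h1
  have h3 := norm_le_add_norm_add (meanDeviation hT (ν n)
    (indicatorConstLp 1 hB (measure_ne_top m B) (1 : ℝ))) (meanDeviation hT (ν n)
    (indicatorConstLp 1 (hA'.diff hB) (measure_ne_top m _) (1 : ℝ)))
  rw [add_comm (meanDeviation hT (ν n) (indicatorConstLp 1 hB _ _))] at h3
  linarith

end WeightedAverage

end MeasurableFlow

/-! ### The Baire category argument -/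

theorem theorem1 {X : Type*} [MeasurableSpace X] (m : Measure X) [IsProbabilityMeasure m]
    [AddAction ℝ X] [MeasurableConstVAdd ℝ X] [ErgodicVAdd ℝ X m]
    (hT : MeasurableFlow.IsMeasurableFlow (X := X) m)
    (hap : MeasurableFlow.IsAperiodicFlow (X := X) m)
    (ν : ℕ → Measure ℝ) [∀ n, IsProbabilityMeasure (ν n)]
    (a : ℕ → ℝ) (ha : Tendsto a atTop (𝓝[>] 0))
    (A' : Set X) (hA' : MeasurableSet A') (hA'pos : 0 < m A')
    (ε : ℝ) (hε : 0 < ε) :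
    ∃ (A : Set X) (hA : MeasurableSet A), m.real (A' ∆ A) < ε ∧
      {n : ℕ | a n < ‖MeasurableFlow.weightedAverage hT (ν n)
          (indicatorConstLp 1 hA (measure_ne_top m A) (1 : ℝ)) -
            Lp.const 1 m (m.real A)‖}.Infinite := by
  have ha0 : Tendsto a atTop (𝓝 0) := ha.mono_right nhdsWithin_le_nhds
  let Y : Set (Lp ℝ 1 m) := {f | ∃ (A : Set X) (hA : MeasurableSet A),
    indicatorConstLp 1 hA (measure_ne_top m A) (1 : ℝ) = f}
  have hYclosed : IsClosed Y := MeasurableFlow.isClosed_setOf_indicatorConstLp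
  have : CompleteSpace Y := hYclosed.completeSpace_coe
  let U : ℕ → Set Y := fun N => ⋃ n ≥ N, {y | a n < ‖MeasurableFlow.meanDeviation hT (ν n) y‖}
  have hUopen : ∀ N, IsOpen (U N) := fun N => isOpen_biUnion fun n _ =>
    isOpen_lt continuous_const
      ((MeasurableFlow.meanDeviation hT (ν n)).continuous.comp continuous_subtype_val).norm
  have hUdense : ∀ N, Dense (U N) := by
    intro N
    rw [Metric.dense_iff]
    rintro ⟨_, C, hC, rfl⟩ δ hδ
    obtain ⟨A, hA, hAC, n, hn, hlt⟩ :=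
      MeasurableFlow.exists_lt_meanDeviation_near hT hap ν ha0 hC hδ N
    refine ⟨⟨_, A, hA, rfl⟩, ?_, mem_iUnion₂.2 ⟨n, hn, hlt⟩⟩
    rw [Metric.mem_ball, dist_comm, Subtype.dist_eq, MeasurableFlow.dist_indicatorConstLp_one]
    exact hAC
  obtain ⟨⟨_, A, hA, rfl⟩, hball, hmem⟩ := Metric.dense_iff.1
    (dense_iInter_of_isOpen hUopen hUdense) ⟨_, A', hA', rfl⟩ ε hε
  refine ⟨A, hA, ?_, Set.infinite_of_forall_exists_gt fun N => ?_⟩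
  · rwa [Metric.mem_ball, dist_comm, Subtype.dist_eq,
      MeasurableFlow.dist_indicatorConstLp_one] at hball
  -- The index `N + 1` gives the strict inequality `N < n` needed for infinitude.
  · obtain ⟨n, hn, hlt⟩ := mem_iUnion₂.1 (mem_iInter.1 hmem (N + 1))
    refine ⟨n, ?_, hn⟩
    rw [mem_ofPred_eq, ← MeasurableFlow.meanDeviation_indicator]
    exact hlt
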